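/- All graphs are finite, simple, undirected and nonempty. A graph $G$ is burned in rounds. Before the first round no vertex is on fire. In each round, first the fire spreads from every burning vertex to all of its neighbors, and then a new vertex that is not yet on fire (if there is one) is chosen and lit. The burning number $b(G)$ is the minimum number of rounds after which all vertices of $G$ can be on fire. A connected graph $G$ on $n$ vertices is called well-burnable if $b(G)\le\lceil\sqrt{n}\,\rceil$. A leaf is a vertex of degree $1$. For a positive integer $d$, let $\mathcal{T}_d$ be the class of trees in which every non-leaf vertex has degree at least $d$. Theorem. For every $d\ge 4$, every tree in $\mathcal{T}_d$ is well-burnable. Moreover, every tree in $\mathcal{T}_3$ on at least $81$ vertices is well-burnable. -/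

import Mathlib

namespace GraphBurning

/-- The vertices on fire after the fire has spread once from the set `B` of burning vertices:
the vertices of `B` and all their neighbours. -/
def spread {V : Type*} (G : SimpleGraph V) (B : Set V) : Set V :=
  B ∪ {v | ∃ u ∈ B, G.Adj u v}

/-- `Burns G t B`: some burning process on `G` has `B` as its set of vertices on fire after
`t` rounds. Before the first round nothing is on fire. In each round the fire first spreads to all
neighbours of burning vertices; then a new vertex, one that is not yet on fire, is lit, unless
no such vertex is left. -/
inductive Burns {V : Type*} (G : SimpleGraph V) : ℕ → Set V → Prop
  | start : Burns G 0 ∅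
  | light {t : ℕ} {B : Set V} (x : V) (h : Burns G t B) (hx : x ∉ spread G B) :
      Burns G (t + 1) (insert x (spread G B))
  | full {t : ℕ} {B : Set V} (h : Burns G t B) (hB : spread G B = Set.univ) :
      Burns G (t + 1) Set.univ

/-- The burning number `b(G)`: the minimum number of rounds in which all vertices of `G` can be
set on fire. For finite `G` the set of which the infimum is taken is nonempty, see
`exists_burns_univ`. -/
noncomputable def burningNumber {V : Type*} (G : SimpleGraph V) : ℕ :=
  sInf {t : ℕ | Burns G t Set.univ}

/-- A finite graph on `n` vertices is well-burnable if `b(G) ≤ ⌈√n⌉`. -/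
def IsWellBurnable {V : Type*} [Fintype V] (G : SimpleGraph V) : Prop :=
  burningNumber G ≤ ⌈Real.sqrt (Fintype.card V : ℝ)⌉₊

/-- The class of trees whose non-leaf vertices have degree at least `d`; a leaf is a vertex of
degree `1`. -/
def IsTreeWithNonLeafDegreeGE {V : Type*} [Fintype V] (G : SimpleGraph V) [DecidableRel G.Adj]
    (d : ℕ) : Prop :=
  G.IsTree ∧ ∀ v : V, G.degree v ≠ 1 → d ≤ G.degree v

/-- A finite graph can be burned completely, so that its burning number is attained. -/
theorem exists_burns_univ {V : Type*} [Fintype V] (G : SimpleGraph V) :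
    ∃ t : ℕ, Burns G t Set.univ := by
  classical
  have key : ∀ t : ℕ, ∃ B : Set V, Burns G t B ∧ (t ≤ B.ncard ∨ B = Set.univ) := by
    intro t
    induction t with
    | zero => exact ⟨∅, Burns.start, Or.inl (Nat.zero_le _)⟩
    | succ t ih =>
      obtain ⟨B, hB, hcard⟩ := ih
      have hsub : B ⊆ spread G B := Set.subset_union_left
      by_cases hfull : spread G B = Set.univ
      · exact ⟨Set.univ, Burns.full hB hfull, Or.inr rfl⟩
      · obtain ⟨x, hx⟩ := (Set.ne_univ_iff_exists_notMem _).1 hfull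
        refine ⟨_, Burns.light x hB hx, Or.inl ?_⟩
        rw [Set.ncard_insert_of_notMem hx (Set.toFinite _)]
        rcases hcard with h | h
        · have := Set.ncard_le_ncard hsub (Set.toFinite _)
          omega
        · exact absurd (Set.univ_subset_iff.1 (h ▸ hsub)) hfull
  obtain ⟨B, hB, h | h⟩ := key (Fintype.card V)
  · refine ⟨_, (?_ : B = Set.univ) ▸ hB⟩
    refine Set.eq_of_subset_of_ncard_le (Set.subset_univ _) ?_ (Set.toFinite _)
    rw [Set.ncard_univ, Nat.card_eq_fintype_card]
    exact h
  · exact ⟨_, h ▸ hB⟩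

end GraphBurning

/-!
A graph burns in `k` rounds as soon as it is covered by closed balls of radii `0, …, k - 1`. For a
tree with `n` vertices, `n₂` of them of degree two, such a cover exists whenever `n + n₂ ≤ k ^ 2`.
Root the tree at a vertex that is not a leaf and give a vertex with exactly one child weight two and
every other vertex weight one, so that the total weight is at most `n + n₂`; then a subtree of
height `h` weighs at least `2 * h + 1`. If the whole tree has height at least `k`, take a vertex of
height `k`. Near it one can cut off either a subtree that lies in a ball of radius `k - 1` and frees
weight `k ^ 2 - (k - 1) ^ 2`, or one that lies in two balls of radii `k - 1` and `k - 2` and frees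
weight `k ^ 2 - (k - 2) ^ 2`. Induct on `k`.
-/

namespace GraphBurning

section Cover

variable {V : Type*} {G : SimpleGraph V}

theorem subset_spread (B : Set V) : B ⊆ spread G B := Set.subset_union_left

theorem spread_mono : Monotone (spread G) := fun _ _ h =>
  Set.union_subset_union h fun _ ⟨u, hu, huv⟩ => ⟨u, h hu, huv⟩

theorem exists_burns_of_spread_iterate (f : ℕ → V) (t : ℕ) :
    ∃ B : Set V, Burns G t B ∧ ∀ i < t, (spread G)^[i] {f i} ⊆ B := by
  induction t generalizing f with
  | zero => exact ⟨∅, .start, by simp⟩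
  | succ t ih =>
    obtain ⟨B, hB, hfB⟩ := ih fun i => f (i + 1)
    have hspread : ∀ i < t, (spread G)^[i + 1] {f (i + 1)} ⊆ spread G B := fun i hi => by
      rw [Function.iterate_succ_apply']
      exact spread_mono (hfB i hi)
    by_cases hfull : spread G B = Set.univ
    · exact ⟨Set.univ, .full hB hfull, fun _ _ => Set.subset_univ _⟩
    obtain ⟨x, hx, hfx⟩ : ∃ x ∉ spread G B, f 0 ∈ insert x (spread G B) := by
      by_cases hf : f 0 ∈ spread G B
      · obtain ⟨x, hx⟩ := (Set.ne_univ_iff_exists_notMem _).1 hfull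
        exact ⟨x, hx, Or.inr hf⟩
      · exact ⟨f 0, hf, Or.inl rfl⟩
    refine ⟨_, .light x hB hx, fun i hi => ?_⟩
    rcases i with _ | i
    · exact Set.singleton_subset_iff.2 hfx
    · exact (hspread i (by lia)).trans (Set.subset_insert _ _)

theorem mem_spread_iterate_of_walk {B : Set V} {u v : V} {n : ℕ} (w : G.Walk u v) (hu : u ∈ B)
    (hn : w.length ≤ n) : v ∈ (spread G)^[n] B := by
  induction w generalizing B n with
  | nil => exact Function.id_le_iterate_of_id_le subset_spread n B hu
  | cons huw w ih =>
    obtain ⟨m, rfl⟩ := Nat.exists_eq_add_one_of_ne_zero (n := n) (by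
      rw [SimpleGraph.Walk.length_cons] at hn; lia)
    exact ih (B := spread G B) (Or.inr ⟨_, hu, huw⟩) (by simpa using hn)

/-- The closed ball of radius `n` around `c` (`SimpleGraph.ball` is the open one). -/
def closedBall (G : SimpleGraph V) (c : V) (n : ℕ) : Set V := {v | G.edist c v ≤ n}

theorem mem_closedBall_of_walk {u v : V} {n : ℕ} (w : G.Walk u v) (hn : w.length ≤ n) :
    v ∈ closedBall G u n :=
  (SimpleGraph.edist_le w).trans (Nat.cast_le.2 hn)

theorem closedBall_subset_spread_iterate (c : V) (n : ℕ) :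
    closedBall G c n ⊆ (spread G)^[n] {c} := by
  intro v (hv : G.edist c v ≤ n)
  obtain ⟨w, hw⟩ := SimpleGraph.exists_walk_of_edist_ne_top (ne_top_of_le_ne_top (by simp) hv)
  exact mem_spread_iterate_of_walk w rfl (Nat.cast_le.1 (hw.trans_le hv))

/-- `S` is covered by `k` closed balls of radii `0, …, k - 1`; the ball of radius `i` is centred
at `f i`. -/
def IsCoverable (G : SimpleGraph V) (k : ℕ) (S : Set V) : Prop :=
  ∃ f : ℕ → V, S ⊆ ⋃ i < k, closedBall G (f i) i

theorem IsCoverable.mono {k : ℕ} {S S' : Set V} (h : IsCoverable G k S) (hS : S' ⊆ S) :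
    IsCoverable G k S' :=
  h.imp fun _ hf => hS.trans hf

theorem IsCoverable.union_closedBall {k : ℕ} {S : Set V} (h : IsCoverable G k S) (c : V) :
    IsCoverable G (k + 1) (S ∪ closedBall G c k) := by
  obtain ⟨f, hf⟩ := h
  refine ⟨Function.update f k c, Set.union_subset (fun v hv => ?_) fun v hv => ?_⟩
  · obtain ⟨i, hi, hvi⟩ := Set.mem_iUnion₂.1 (hf hv)
    exact Set.mem_iUnion₂.2 ⟨i, by lia, by rwa [Function.update_of_ne hi.ne]⟩
  · exact Set.mem_iUnion₂.2 ⟨k, by lia, by rwa [Function.update_self]⟩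

theorem IsCoverable.burningNumber_le {k : ℕ} (h : IsCoverable G k Set.univ) :
    burningNumber G ≤ k := by
  obtain ⟨f, hf⟩ := h
  obtain ⟨B, hB, hfB⟩ := exists_burns_of_spread_iterate (G := G) f k
  have hBuniv : B = Set.univ := Set.univ_subset_iff.1 <| hf.trans <| Set.iUnion₂_subset
    fun i hi => (closedBall_subset_spread_iterate _ _).trans (hfB i hi)
  exact Nat.sInf_le (hBuniv ▸ hB)

end Cover

/-- A rooting of a tree, given by its parent map and depth function. The root is its own parent, so
that `parent` can be iterated freely. -/
structure Rooting {V : Type*} (G : SimpleGraph V) where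
  root : V
  parent : V → V
  depth : V → ℕ
  parent_root : parent root = root
  depth_root : depth root = 0
  depth_parent_add_one : ∀ {v}, v ≠ root → depth (parent v) + 1 = depth v
  adj_iff : ∀ {u v}, G.Adj u v ↔ u ≠ v ∧ (parent u = v ∨ parent v = u)

theorem exists_rooting {V : Type*} {G : SimpleGraph V} (hG : G.IsTree) (r : V) :
    ∃ T : Rooting G, T.root = r := by
  choose P hP hPuniq using fun v => hG.existsUnique_path v r
  have hPr : P r = .nil := (hPuniq r _ .nil).symm
  have hadj : ∀ {v}, v ≠ r → G.Adj v (P v).snd := fun hv =>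
    SimpleGraph.Walk.adj_snd (SimpleGraph.Walk.not_nil_of_ne hv)
  have hsymm : ∀ {u v}, u ≠ v → (P u).snd = v → G.Adj u v := by
    rintro u _ huv rfl
    refine hadj fun hur => huv ?_
    subst hur
    simp [hPr]
  refine ⟨⟨r, fun v => (P v).snd, fun v => (P v).length, by simp [hPr], by simp [hPr], ?_, ?_⟩, rfl⟩
  · intro v hv
    rw [← hPuniq _ _ (hP v).tail,
      SimpleGraph.Walk.length_tail_add_one (SimpleGraph.Walk.not_nil_of_ne hv)]
  · refine fun {u v} => ⟨fun huv => ⟨huv.ne, ?_⟩, fun ⟨hne, h⟩ =>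
      h.elim (hsymm hne) fun h => (hsymm hne.symm h).symm⟩
    by_cases hv : v ∈ (P u).support
    · exact Or.inl (hG.isAcyclic.eq_snd_of_adj_start (hP u) huv hv).symm
    · right
      rw [← hPuniq v _ ((hP u).cons (h := huv.symm) hv), SimpleGraph.Walk.snd_cons]

namespace Rooting

variable {V : Type*} {G : SimpleGraph V} {T : Rooting G}

section Descendants

variable {u v w : V} {a b n : ℕ}

theorem adj_parent (hv : v ≠ T.root) : G.Adj v (T.parent v) :=
  T.adj_iff.2 ⟨fun h => by have := T.depth_parent_add_one hv; rw [← h] at this; lia, Or.inl rfl⟩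

theorem exists_walk_iterate_parent (v : V) (a : ℕ) :
    ∃ w : G.Walk v (T.parent^[a] v), w.length ≤ a := by
  induction a with
  | zero => exact ⟨.nil, le_rfl⟩
  | succ a ih =>
    obtain ⟨w, hw⟩ := ih
    rw [Function.iterate_succ_apply']
    by_cases hr : T.parent^[a] v = T.root
    · rw [hr, T.parent_root, ← hr]
      exact ⟨w, by lia⟩
    · exact ⟨w.concat (adj_parent hr), by rw [SimpleGraph.Walk.length_concat]; lia⟩

theorem mem_closedBall_of_iterate_parent_eq (h : T.parent^[a] u = T.parent^[b] v)
    (hn : a + b ≤ n) : v ∈ closedBall G u n := by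
  obtain ⟨p, hp⟩ := T.exists_walk_iterate_parent u a
  obtain ⟨q, hq⟩ := T.exists_walk_iterate_parent v b
  refine mem_closedBall_of_walk ((p.copy rfl h).append q.reverse) ?_
  rw [SimpleGraph.Walk.length_append, SimpleGraph.Walk.length_copy, SimpleGraph.Walk.length_reverse]
  lia

theorem depth_iterate_parent (v : V) (a : ℕ) : T.depth (T.parent^[a] v) = T.depth v - a := by
  induction a with
  | zero => rfl
  | succ a ih =>
    rw [Function.iterate_succ_apply']
    by_cases hr : T.parent^[a] v = T.root
    · rw [hr, T.depth_root] at ih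
      rw [hr, T.parent_root, T.depth_root]
      lia
    · have := T.depth_parent_add_one hr
      lia

theorem iterate_parent_eq_root (h : T.depth v ≤ a) : T.parent^[a] v = T.root := by
  by_contra hne
  have := T.depth_parent_add_one hne
  rw [depth_iterate_parent] at this
  lia

/-- `u` is a descendant of `v`; every vertex is a descendant of itself. -/
def IsDescendant (T : Rooting G) (u v : V) : Prop := ∃ a, T.parent^[a] u = v

theorem IsDescendant.refl (v : V) : T.IsDescendant v v := ⟨0, rfl⟩

theorem IsDescendant.trans (huv : T.IsDescendant u v) (hvw : T.IsDescendant v w) :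
    T.IsDescendant u w := by
  obtain ⟨a, rfl⟩ := huv
  obtain ⟨b, rfl⟩ := hvw
  exact ⟨b + a, Function.iterate_add_apply _ _ _ _⟩

theorem isDescendant_parent (v : V) : T.IsDescendant v (T.parent v) := ⟨1, rfl⟩

theorem isDescendant_root (v : V) : T.IsDescendant v T.root :=
  ⟨T.depth v, iterate_parent_eq_root le_rfl⟩

theorem IsDescendant.depth_le (h : T.IsDescendant u v) : T.depth v ≤ T.depth u := by
  obtain ⟨a, rfl⟩ := h
  rw [depth_iterate_parent]
  lia

theorem IsDescendant.iterate_parent_eq (h : T.IsDescendant u v) :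
    T.parent^[T.depth u - T.depth v] u = v := by
  obtain ⟨a, rfl⟩ := h
  rw [depth_iterate_parent]
  rcases le_total a (T.depth u) with ha | ha
  · rw [Nat.sub_sub_self ha]
  · rw [iterate_parent_eq_root ha, iterate_parent_eq_root (by lia)]

end Descendants

section Subtree

open Finset

/-- `S` contains the parent of each of its vertices, so it spans a subtree containing the root
unless it is empty. -/
def ParentClosed (T : Rooting G) (S : Finset V) : Prop := ∀ v ∈ S, T.parent v ∈ S

open Classical in
/-- The children of `v` that lie in `S`. -/
noncomputable def children (T : Rooting G) (S : Finset V) (v : V) : Finset V :=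
  {u ∈ S | u ≠ T.root ∧ T.parent u = v}

open Classical in
/-- The descendants of `v` that lie in `S`. -/
noncomputable def subtree (T : Rooting G) (S : Finset V) (v : V) : Finset V :=
  {u ∈ S | T.IsDescendant u v}

/-- The height of the subtree of `S` below `v`. -/
noncomputable def height (T : Rooting G) (S : Finset V) (v : V) : ℕ :=
  (T.subtree S v).sup fun u => T.depth u - T.depth v

variable {S : Finset V} {u v w p : V} {h n : ℕ}

theorem mem_children : u ∈ T.children S v ↔ u ∈ S ∧ u ≠ T.root ∧ T.parent u = v := by
  simp [children]

theorem mem_subtree : u ∈ T.subtree S v ↔ u ∈ S ∧ T.IsDescendant u v := by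
  simp [subtree]

theorem subtree_subset : T.subtree S v ⊆ S := fun _ hu => (mem_subtree.1 hu).1

theorem subtree_root : T.subtree S T.root = S := by
  simp [subtree, isDescendant_root]

theorem self_mem_subtree (hv : v ∈ S) : v ∈ T.subtree S v := mem_subtree.2 ⟨hv, .refl v⟩

theorem mem_of_mem_children (hu : u ∈ T.children S v) : u ∈ S := (mem_children.1 hu).1

theorem depth_of_mem_children (hu : u ∈ T.children S v) : T.depth u = T.depth v + 1 := by
  obtain ⟨-, hur, rfl⟩ := mem_children.1 hu
  exact (T.depth_parent_add_one hur).symm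

theorem isDescendant_of_mem_children (hu : u ∈ T.children S v) : T.IsDescendant u v := by
  obtain ⟨-, -, rfl⟩ := mem_children.1 hu
  exact isDescendant_parent u

theorem subtree_subset_subtree (hu : u ∈ T.subtree S v) : T.subtree S u ⊆ T.subtree S v := by
  simp only [subset_iff, mem_subtree]
  exact fun x hx => ⟨hx.1, hx.2.trans (mem_subtree.1 hu).2⟩

theorem children_subset_subtree : T.children S v ⊆ T.subtree S v := fun _ hu =>
  mem_subtree.2 ⟨mem_of_mem_children hu, isDescendant_of_mem_children hu⟩

theorem notMem_subtree_of_mem_children (hu : u ∈ T.children S v) : v ∉ T.subtree S u := by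
  intro hv
  have := (mem_subtree.1 hv).2.depth_le
  have := depth_of_mem_children hu
  lia

theorem pairwiseDisjoint_subtree_children :
    (T.children S p : Set V).PairwiseDisjoint (T.subtree S) := by
  intro u hu v hv huv
  rw [Function.onFun, disjoint_left]
  intro x hxu hxv
  apply huv
  rw [← (mem_subtree.1 hxu).2.iterate_parent_eq, ← (mem_subtree.1 hxv).2.iterate_parent_eq,
    depth_of_mem_children hu, depth_of_mem_children hv]

theorem ParentClosed.iterate_parent_mem (hS : T.ParentClosed S) (hv : v ∈ S) (a : ℕ) :
    T.parent^[a] v ∈ S := by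
  induction a with
  | zero => exact hv
  | succ a ih => rw [Function.iterate_succ_apply']; exact hS _ ih

theorem ParentClosed.root_mem (hS : T.ParentClosed S) (hv : v ∈ S) : T.root ∈ S := by
  obtain ⟨a, ha⟩ := T.isDescendant_root v
  exact ha ▸ hS.iterate_parent_mem hv a

theorem ParentClosed.eq_or_exists_mem_children (hS : T.ParentClosed S) (hu : u ∈ T.subtree S v) :
    u = v ∨ ∃ w ∈ T.children S v, u ∈ T.subtree S w := by
  obtain ⟨huS, hdesc⟩ := mem_subtree.1 hu
  have hiter := hdesc.iterate_parent_eq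
  rcases hd : T.depth u - T.depth v with _ | d
  · exact Or.inl (by rwa [hd] at hiter)
  rw [hd, Function.iterate_succ_apply'] at hiter
  have hne : T.parent^[d] u ≠ T.root := fun hr => by
    have := T.depth_iterate_parent u d
    rw [hr, T.depth_root] at this
    lia
  exact Or.inr ⟨T.parent^[d] u, mem_children.2 ⟨hS.iterate_parent_mem huS d, hne, hiter⟩,
    mem_subtree.2 ⟨huS, d, rfl⟩⟩

theorem ParentClosed.subtree_eq [DecidableEq V] (hS : T.ParentClosed S) (hv : v ∈ S) :
    T.subtree S v = insert v ((T.children S v).biUnion (T.subtree S)) := by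
  ext u
  rw [mem_insert, mem_biUnion]
  refine ⟨hS.eq_or_exists_mem_children, ?_⟩
  rintro (rfl | ⟨w, hw, hu⟩)
  · exact self_mem_subtree hv
  · exact subtree_subset_subtree (children_subset_subtree hw) hu

theorem depth_le_depth_add_height (hu : u ∈ T.subtree S v) :
    T.depth u ≤ T.depth v + T.height S v :=
  Nat.sub_le_iff_le_add'.1 (le_sup (f := fun u => T.depth u - T.depth v) hu)

theorem exists_depth_eq_depth_add_height (hv : v ∈ S) :
    ∃ u ∈ T.subtree S v, T.depth u = T.depth v + T.height S v := by
  obtain ⟨u, hu, huh⟩ := exists_mem_eq_sup (T.subtree S v) ⟨v, self_mem_subtree hv⟩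
    fun u => T.depth u - T.depth v
  have hle := (mem_subtree.1 hu).2.depth_le
  exact ⟨u, hu, by rw [height, huh]; lia⟩

theorem height_lt_of_mem_children (hu : u ∈ T.children S v) : T.height S u < T.height S v := by
  obtain ⟨x, hx, hxh⟩ := T.exists_depth_eq_depth_add_height (mem_of_mem_children hu)
  have := depth_le_depth_add_height (subtree_subset_subtree (children_subset_subtree hu) hx)
  have := depth_of_mem_children hu
  lia

theorem ParentClosed.exists_mem_children_height_eq (hS : T.ParentClosed S) (hv : v ∈ S)
    (hh : T.height S v = h + 1) : ∃ u ∈ T.children S v, T.height S u = h := by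
  obtain ⟨x, hx, hxh⟩ := T.exists_depth_eq_depth_add_height hv
  rcases hS.eq_or_exists_mem_children hx with rfl | ⟨u, hu, hxu⟩
  · lia
  refine ⟨u, hu, ?_⟩
  have := depth_le_depth_add_height hxu
  have := depth_of_mem_children hu
  have := height_lt_of_mem_children hu
  lia

theorem ParentClosed.exists_mem_height_eq (hS : T.ParentClosed S) (hv : v ∈ S)
    (hh : h ≤ T.height S v) : ∃ p ∈ S, T.height S p = h := by
  induction hh using Nat.decreasingInduction with
  | self => exact ⟨v, hv, rfl⟩
  | of_succ n _ ih =>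
    obtain ⟨p, hp, hpn⟩ := ih
    obtain ⟨u, hu, hun⟩ := hS.exists_mem_children_height_eq hp hpn
    exact ⟨u, mem_of_mem_children hu, hun⟩

theorem subtree_subset_closedBall (hn : T.height S v ≤ n) :
    ↑(T.subtree S v) ⊆ closedBall G v n := fun u hu =>
  mem_closedBall_of_iterate_parent_eq (a := 0) (b := T.depth u - T.depth v)
    (mem_subtree.1 hu).2.iterate_parent_eq.symm
    (by have := depth_le_depth_add_height hu; lia)

theorem mem_closedBall_of_mem_children (hv : v ∈ T.children S p) (hn : 1 ≤ n) :
    p ∈ closedBall G v n :=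
  mem_closedBall_of_iterate_parent_eq (a := 1) (b := 0) (mem_children.1 hv).2.2 hn

theorem subtree_subset_closedBall_sibling (hv : v ∈ T.children S p) (hw : w ∈ T.children S p)
    (hn : T.height S w + 2 ≤ n) : ↑(T.subtree S w) ⊆ closedBall G v n := by
  intro u hu
  have hup := (mem_subtree.1 hu).2.trans (isDescendant_of_mem_children hw)
  refine mem_closedBall_of_iterate_parent_eq (a := 1) (b := T.depth u - T.depth p)
    ((mem_children.1 hv).2.2.trans hup.iterate_parent_eq.symm) ?_
  have := depth_le_depth_add_height hu
  have := depth_of_mem_children hw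
  lia

theorem ParentClosed.subtree_subset_closedBall_child (hS : T.ParentClosed S)
    (hv : v ∈ T.children S p) (hn : 1 ≤ n) (hvn : T.height S v ≤ n)
    (hshallow : ∀ w ∈ T.children S p, w ≠ v → T.height S w + 2 ≤ n) :
    ↑(T.subtree S p) ⊆ closedBall G v n := by
  intro u hu
  rcases hS.eq_or_exists_mem_children hu with rfl | ⟨w, hw, huw⟩
  · exact mem_closedBall_of_mem_children hv hn
  by_cases hwv : w = v
  · exact subtree_subset_closedBall hvn (hwv ▸ huw)
  · exact subtree_subset_closedBall_sibling hv hw (hshallow w hw hwv) huw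

theorem ParentClosed.subtree_subset_closedBall_or_exists_deep_children (hS : T.ParentClosed S)
    (hp : p ∈ S) (hh : T.height S p = h + 1) (hpos : 1 ≤ h) :
    (∃ c, ↑(T.subtree S p) ⊆ closedBall G c h) ∨
      ∃ v ∈ T.children S p, ∃ w ∈ T.children S p,
        v ≠ w ∧ T.height S v = h ∧ h ≤ T.height S w + 1 := by
  obtain ⟨v, hv, hvh⟩ := hS.exists_mem_children_height_eq hp hh
  by_cases hshallow : ∀ w ∈ T.children S p, w ≠ v → T.height S w + 2 ≤ h
  · exact Or.inl ⟨v, hS.subtree_subset_closedBall_child hv hpos hvh.le hshallow⟩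
  · push Not at hshallow
    obtain ⟨w, hw, hwv, hwh⟩ := hshallow
    exact Or.inr ⟨v, hv, w, hw, hwv.symm, hvh, by lia⟩

theorem ParentClosed.subtree_subset_union_closedBall (hS : T.ParentClosed S)
    (hv : v ∈ T.children S p) (hw : w ∈ T.children S p) (hvw : v ≠ w)
    (hcard : #(T.children S p) ≤ 2) (hn : 1 ≤ n) (hvn : T.height S v ≤ n) :
    (T.subtree S p : Set V) ⊆ T.subtree S w ∪ closedBall G v n := by
  classical
  have hchildren : {v, w} = T.children S p :=
    eq_of_subset_of_card_le (by simp [insert_subset_iff, hv, hw]) (by rwa [card_pair hvw])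
  intro u hu
  rcases hS.eq_or_exists_mem_children hu with rfl | ⟨x, hx, hux⟩
  · exact Or.inr (mem_closedBall_of_mem_children hv hn)
  rw [← hchildren, mem_insert, mem_singleton] at hx
  rcases hx with rfl | rfl
  · exact Or.inr (subtree_subset_closedBall hvn hux)
  · exact Or.inl hux

end Subtree

section Weight

open Finset

/-- The weight of `v` in `S`: two if `v` has exactly one child in `S`, and one otherwise. -/
noncomputable def vertexWeight (T : Rooting G) (S : Finset V) (v : V) : ℕ :=
  1 + if #(T.children S v) = 1 then 1 else 0

/-- The total weight of the vertices of `S`, that is `#S` plus the number of vertices with exactly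
one child in `S`. -/
noncomputable def weight (T : Rooting G) (S : Finset V) : ℕ := ∑ v ∈ S, T.vertexWeight S v

variable {S : Finset V} {v w p : V} {h : ℕ}

theorem one_le_vertexWeight : 1 ≤ T.vertexWeight S v := Nat.le_add_right _ _

theorem vertexWeight_le_two : T.vertexWeight S v ≤ 2 := by unfold vertexWeight; split <;> lia

theorem card_le_weight : #S ≤ T.weight S := by
  simpa [weight] using card_nsmul_le_sum S _ 1 fun v _ => T.one_le_vertexWeight

theorem weight_le_two_mul_card : T.weight S ≤ 2 * #S := by
  simpa [weight, mul_comm] using sum_le_card_nsmul S _ 2 fun v _ => T.vertexWeight_le_two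

theorem weight_subtree : T.weight (T.subtree S p) = ∑ v ∈ T.subtree S p, T.vertexWeight S v := by
  refine sum_congr rfl fun v hv => ?_
  have hchildren : T.children (T.subtree S p) v = T.children S v := by
    ext u
    simp only [mem_children, mem_subtree]
    refine ⟨fun hu => ⟨hu.1.1, hu.2⟩, fun hu => ⟨⟨hu.1, ?_⟩, hu.2⟩⟩
    exact (isDescendant_of_mem_children (mem_children.2 hu)).trans (mem_subtree.1 hv).2
  rw [vertexWeight, vertexWeight, hchildren]

theorem weight_subtree_le : T.weight (T.subtree S p) ≤ T.weight S := by
  rw [weight_subtree]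
  exact sum_le_sum_of_subset subtree_subset

theorem ParentClosed.weight_subtree_eq (hS : T.ParentClosed S) (hv : v ∈ S) :
    T.weight (T.subtree S v) =
      T.vertexWeight S v + ∑ u ∈ T.children S v, T.weight (T.subtree S u) := by
  classical
  have hnotMem : v ∉ (T.children S v).biUnion (T.subtree S) := by
    simpa using fun u hu => notMem_subtree_of_mem_children hu
  rw [weight_subtree, hS.subtree_eq hv, sum_insert hnotMem,
    sum_biUnion pairwiseDisjoint_subtree_children]
  simp only [weight_subtree]

theorem one_le_weight_subtree (hv : v ∈ S) : 1 ≤ T.weight (T.subtree S v) :=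
  (card_pos.2 ⟨v, self_mem_subtree hv⟩).trans_le card_le_weight

theorem ParentClosed.weight_subtree_add_weight_subtree_lt (hS : T.ParentClosed S) (hp : p ∈ S)
    (hv : v ∈ T.children S p) (hw : w ∈ T.children S p) (hvw : v ≠ w) :
    T.weight (T.subtree S v) + T.weight (T.subtree S w) < T.weight (T.subtree S p) := by
  rw [hS.weight_subtree_eq hp]
  have := T.one_le_vertexWeight (S := S) (v := p)
  have := add_le_sum (f := fun u => T.weight (T.subtree S u)) (fun _ _ => Nat.zero_le _) hv hw hvw
  lia

theorem ParentClosed.weight_subtree_add_two_le (hS : T.ParentClosed S) (hp : p ∈ S)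
    (hv : v ∈ T.children S p) : T.weight (T.subtree S v) + 2 ≤ T.weight (T.subtree S p) := by
  by_cases hcard : #(T.children S p) = 1
  · have hpw : T.vertexWeight S p = 2 := by simp [vertexWeight, hcard]
    rw [hS.weight_subtree_eq hp, hpw, add_comm]
    gcongr
    exact single_le_sum (f := fun u => T.weight (T.subtree S u)) (fun _ _ => Nat.zero_le _) hv
  · have hpos := card_pos.2 ⟨v, hv⟩
    obtain ⟨w, hw, hwv⟩ := exists_mem_ne (show 1 < #(T.children S p) by lia) v
    have := hS.weight_subtree_add_weight_subtree_lt hp hv hw hwv.symm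
    have := T.one_le_weight_subtree (mem_of_mem_children hw)
    lia

theorem ParentClosed.two_mul_height_lt_weight (hS : T.ParentClosed S) (hv : v ∈ S) :
    2 * T.height S v < T.weight (T.subtree S v) := by
  induction hh : T.height S v generalizing v with
  | zero => exact one_le_weight_subtree hv
  | succ h ih =>
    obtain ⟨u, hu, huh⟩ := hS.exists_mem_children_height_eq hv hh
    have := ih (mem_of_mem_children hu) huh
    have := hS.weight_subtree_add_two_le hv hu
    lia

theorem ParentClosed.four_mul_lt_weight_subtree (hS : T.ParentClosed S) (hp : p ∈ S)
    (hv : v ∈ T.children S p) (hw : w ∈ T.children S p) (hvw : v ≠ w)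
    (hvh : h ≤ T.height S v) (hwh : h ≤ T.height S w + 1) :
    4 * h < T.weight (T.subtree S p) := by
  have := hS.weight_subtree_add_weight_subtree_lt hp hv hw hvw
  have := hS.two_mul_height_lt_weight (mem_of_mem_children hv)
  have := hS.two_mul_height_lt_weight (mem_of_mem_children hw)
  lia

theorem ParentClosed.four_mul_lt_weight_subtree_of_not_subset_closedBall (hS : T.ParentClosed S)
    (hp : p ∈ S) (hh : T.height S p = h + 1)
    (hball : ¬∃ c, ↑(T.subtree S p) ⊆ closedBall G c h) :
    4 * h < T.weight (T.subtree S p) := by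
  rcases Nat.eq_zero_or_pos h with rfl | hpos
  · exact one_le_weight_subtree hp
  obtain ⟨v, hv, w, hw, hvw, hvh, hwh⟩ :=
    (hS.subtree_subset_closedBall_or_exists_deep_children hp hh hpos).resolve_left hball
  exact hS.four_mul_lt_weight_subtree hp hv hw hvw hvh.ge hwh

end Weight

section Pruning

open Finset

variable [DecidableEq V] {S : Finset V} {v p : V} {k : ℕ}

theorem ParentClosed.sdiff_subtree (hS : T.ParentClosed S) (p : V) :
    T.ParentClosed (S \ T.subtree S p) := by
  intro v hv
  rw [mem_sdiff, mem_subtree] at hv ⊢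
  exact ⟨hS v hv.1, fun h => hv.2 ⟨hv.1, (isDescendant_parent v).trans h.2⟩⟩

theorem children_sdiff_subtree (hv : v ∈ S \ T.subtree S p) :
    T.children (S \ T.subtree S p) v = (T.children S v).erase p := by
  rw [mem_sdiff, mem_subtree] at hv
  ext u
  simp only [mem_erase, mem_children, mem_sdiff, mem_subtree]
  refine ⟨fun ⟨⟨huS, hup⟩, hu⟩ => ⟨?_, huS, hu⟩, fun ⟨hup, huS, hu⟩ => ⟨⟨huS, ?_⟩, hu⟩⟩
  · rintro rfl
    exact hup ⟨huS, .refl u⟩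
  · rintro ⟨-, _ | a, ha⟩
    · exact hup ha
    · rw [Function.iterate_succ_apply, hu.2] at ha
      exact hv.2 ⟨hv.1, a, ha⟩

theorem vertexWeight_sdiff_subtree (hv : v ∈ S \ T.subtree S p) (hvp : v ≠ T.parent p) :
    T.vertexWeight (S \ T.subtree S p) v = T.vertexWeight S v := by
  have hp : p ∉ T.children S v := fun hp => hvp (mem_children.1 hp).2.2.symm
  rw [vertexWeight, vertexWeight, children_sdiff_subtree hv, erase_eq_of_notMem hp]

theorem weight_sdiff_subtree_add_le {e : ℕ}
    (he : ∀ v ∈ S \ T.subtree S p, v = T.parent p →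
      T.vertexWeight (S \ T.subtree S p) v ≤ T.vertexWeight S v + e) :
    T.weight (S \ T.subtree S p) + T.weight (T.subtree S p) ≤ T.weight S + e := by
  have hsum : T.weight (S \ T.subtree S p) ≤ ∑ v ∈ S \ T.subtree S p, T.vertexWeight S v + e :=
    calc
      T.weight (S \ T.subtree S p)
        ≤ ∑ v ∈ S \ T.subtree S p, (T.vertexWeight S v + if v = T.parent p then e else 0) := by
          refine sum_le_sum fun v hv => ?_
          by_cases hvp : v = T.parent p
          · simpa only [if_pos hvp] using he v hv hvp
          · simp only [if_neg hvp, vertexWeight_sdiff_subtree hv hvp, add_zero, le_rfl]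
      _ ≤ ∑ v ∈ S \ T.subtree S p, T.vertexWeight S v + e := by
          rw [sum_add_distrib, sum_ite_eq']
          split <;> lia
  have hsplit : ∑ v ∈ S \ T.subtree S p, T.vertexWeight S v + T.weight (T.subtree S p) =
      T.weight S := by
    rw [weight_subtree, sum_sdiff subtree_subset, weight]
  lia

theorem weight_sdiff_subtree_add_le_add_one :
    T.weight (S \ T.subtree S p) + T.weight (T.subtree S p) ≤ T.weight S + 1 :=
  weight_sdiff_subtree_add_le fun _ _ _ =>
    vertexWeight_le_two.trans (Nat.add_le_add_right one_le_vertexWeight 1)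

theorem weight_sdiff_subtree_add_le_of_two_lt_card_children (hv : v ∈ T.children S p)
    (hcard : 2 < #(T.children S p)) :
    T.weight (S \ T.subtree S v) + T.weight (T.subtree S v) ≤ T.weight S := by
  refine weight_sdiff_subtree_add_le (e := 0) fun q hq hqv => ?_
  obtain rfl : p = q := (mem_children.1 hv).2.2.symm.trans hqv.symm
  rw [vertexWeight, children_sdiff_subtree hq, card_erase_of_mem hv, if_neg (by lia)]
  exact one_le_vertexWeight

theorem ParentClosed.exists_subtree_to_prune {j : ℕ} (hS : T.ParentClosed S) (hp : p ∈ S)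
    (hh : T.height S p = j + 2) (hweight : T.weight S ≤ (j + 2) ^ 2) :
    (∃ x c, T.weight (S \ T.subtree S x) ≤ (j + 1) ^ 2 ∧
      ↑(T.subtree S x) ⊆ closedBall G c (j + 1)) ∨
    ∃ x c d, T.weight (S \ T.subtree S x) ≤ j ^ 2 ∧
      ↑(T.subtree S x) ⊆ closedBall G c j ∪ closedBall G d (j + 1) := by
  have hsq₁ : (j + 2) ^ 2 = (j + 1) ^ 2 + (2 * j + 3) := by ring
  have hsq₂ : (j + 2) ^ 2 = j ^ 2 + (4 * j + 4) := by ring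
  have hprune := fun x => T.weight_sdiff_subtree_add_le_add_one (S := S) (p := x)
  obtain ⟨c, hc⟩ | ⟨v, hv, w, hw, hvw, hvh, hwh⟩ :=
    hS.subtree_subset_closedBall_or_exists_deep_children hp hh (by lia)
  · have := hS.two_mul_height_lt_weight hp
    exact Or.inl ⟨p, c, by have := hprune p; lia, hc⟩
  have hvweight := hS.two_mul_height_lt_weight (mem_of_mem_children hv)
  by_cases hcard : 2 < #(T.children S p)
  · -- `p` keeps at least two children, so its weight does not rise when `v` is cut off.
    have := weight_sdiff_subtree_add_le_of_two_lt_card_children hv hcard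
    exact Or.inl ⟨v, v, by lia, subtree_subset_closedBall hvh.le⟩
  by_cases hcentre : ∃ c, ↑(T.subtree S w) ⊆ closedBall G c j
  · obtain ⟨c, hc⟩ := hcentre
    have := hS.four_mul_lt_weight_subtree hp hv hw hvw hvh.ge hwh
    exact Or.inr ⟨p, c, v, by have := hprune p; lia,
      (hS.subtree_subset_union_closedBall hv hw hvw (by lia) (by lia) hvh.le).trans
        (Set.union_subset_union_left _ hc)⟩
  have hwheight : T.height S w = j + 1 := by
    have := height_lt_of_mem_children hw
    by_contra hne
    exact hcentre ⟨w, subtree_subset_closedBall (by lia)⟩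
  have := hS.four_mul_lt_weight_subtree_of_not_subset_closedBall (mem_of_mem_children hw)
    hwheight hcentre
  have hj : 2 ≤ j := by
    have := hS.two_mul_height_lt_weight (mem_of_mem_children hw)
    have := hS.weight_subtree_add_weight_subtree_lt hp hv hw hvw
    have := T.weight_subtree_le (S := S) (p := p)
    by_contra! hj
    interval_cases j <;> lia
  exact Or.inl ⟨w, w, by have := hprune w; lia, subtree_subset_closedBall hwheight.le⟩

theorem isCoverable_of_sdiff_subtree {B : Set V} (h : IsCoverable G k (↑(S \ T.subtree S p) ∪ B))
    (hB : ↑(T.subtree S p) ⊆ B) : IsCoverable G k (S : Set V) :=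
  h.mono fun v hv => by
    by_cases hvp : v ∈ T.subtree S p
    · exact Or.inr (hB hvp)
    · exact Or.inl (mem_coe.2 (mem_sdiff.2 ⟨hv, hvp⟩))

end Pruning

section Covering

open Finset

theorem ParentClosed.isCoverable {S : Finset V} {k : ℕ} (hS : T.ParentClosed S)
    (hk : T.weight S ≤ k ^ 2) : IsCoverable G k S := by
  classical
  induction k using Nat.strong_induction_on generalizing S with
  | _ k ih =>
  obtain rfl | ⟨v, hv⟩ := S.eq_empty_or_nonempty
  · exact ⟨fun _ => T.root, by simp⟩
  have hroot := hS.root_mem hv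
  have hheight := hS.two_mul_height_lt_weight hroot
  rw [subtree_root] at hheight
  by_cases hlow : T.height S T.root < k
  · refine ⟨fun _ => T.root, fun u hu => Set.mem_iUnion₂.2 ⟨_, hlow, ?_⟩⟩
    exact subtree_subset_closedBall le_rfl (subtree_root.symm ▸ hu)
  obtain ⟨j, rfl⟩ : ∃ j, k = j + 2 := Nat.exists_eq_add_of_le' <| by
    by_contra! hk'
    interval_cases k <;> lia
  obtain ⟨p, hp, hpj⟩ := hS.exists_mem_height_eq hroot (not_lt.1 hlow)
  obtain ⟨x, c, hx, hc⟩ | ⟨x, c, d, hx, hcd⟩ := hS.exists_subtree_to_prune hp hpj hk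
  · have := (ih (j + 1) (by lia) (hS.sdiff_subtree x) hx).union_closedBall c
    exact isCoverable_of_sdiff_subtree this hc
  · have := ((ih j (by lia) (hS.sdiff_subtree x) hx).union_closedBall c).union_closedBall d
    rw [Set.union_assoc] at this
    exact isCoverable_of_sdiff_subtree this hcd

end Covering

section Degree

open Finset

variable [Fintype V]

theorem burningNumber_le_of_weight_le {k : ℕ} (T : Rooting G) (hk : T.weight univ ≤ k ^ 2) :
    burningNumber G ≤ k := by
  classical
  have hcover := ParentClosed.isCoverable (fun v _ => mem_univ (T.parent v)) hk
  rw [coe_univ] at hcover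
  exact hcover.burningNumber_le

variable [DecidableRel G.Adj]

theorem children_univ [DecidableEq V] (v : V) :
    T.children univ v = (G.neighborFinset v).erase (T.parent v) := by
  ext u
  rw [mem_erase, SimpleGraph.mem_neighborFinset, mem_children]
  constructor
  · rintro ⟨-, hu, rfl⟩
    have hdepth := T.depth_parent_add_one hu
    refine ⟨fun hup => ?_, (adj_parent hu).symm⟩
    have := T.depth_iterate_parent u 2
    rw [Function.iterate_succ_apply', Function.iterate_one, ← hup] at this
    lia
  · rintro ⟨hup, hvu⟩
    have hparent : T.parent u = v := (T.adj_iff.1 hvu).2.resolve_left hup.symm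
    refine ⟨mem_univ u, fun hu => hvu.ne ?_, hparent⟩
    rw [← hparent, hu, T.parent_root]

theorem degree_eq_two_of_card_children_eq_one {v : V} (hroot : G.degree T.root ≠ 1)
    (hv : #(T.children univ v) = 1) : G.degree v = 2 := by
  classical
  rw [children_univ] at hv
  by_cases hvr : v = T.root
  · subst hvr
    rw [T.parent_root, erase_eq_of_notMem (by simp)] at hv
    exact absurd hv hroot
  · rw [card_erase_of_mem ((G.mem_neighborFinset _ _).2 (adj_parent hvr)),
      G.card_neighborFinset_eq_degree] at hv
    lia

theorem weight_univ_le (hroot : G.degree T.root ≠ 1) :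
    T.weight univ ≤ Fintype.card V + #{v | G.degree v = 2} := by
  rw [weight, ← card_univ, card_eq_sum_ones, card_filter, ← sum_add_distrib]
  refine sum_le_sum fun v _ => Nat.add_le_add_left ?_ 1
  by_cases hchildren : #(T.children univ v) = 1
  · rw [if_pos hchildren, if_pos (degree_eq_two_of_card_children_eq_one hroot hchildren)]
  · rw [if_neg hchildren]
    exact Nat.zero_le _

end Degree

end Rooting

section Tree

open Finset

variable {V : Type*} [Fintype V] {G : SimpleGraph V} [DecidableRel G.Adj]

theorem card_eq_two_of_forall_degree_eq_one (hG : G.IsTree) (hdeg : ∀ v, G.degree v = 1) :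
    Fintype.card V = 2 := by
  have hedges := hG.card_edgeFinset
  have hsum := G.sum_degrees_eq_twice_card_edges
  simp only [hdeg, sum_const, card_univ, smul_eq_mul, mul_one] at hsum
  lia

theorem burningNumber_le_of_card_add_le_sq {k : ℕ} (hG : G.IsTree)
    (hk : Fintype.card V + #{v | G.degree v = 2} ≤ k ^ 2) : burningNumber G ≤ k := by
  by_cases hdeg : ∀ v, G.degree v = 1
  · have hcard := card_eq_two_of_forall_degree_eq_one hG hdeg
    obtain ⟨r⟩ := hG.connected.nonempty
    obtain ⟨T, -⟩ := exists_rooting hG r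
    refine T.burningNumber_le_of_weight_le (T.weight_le_two_mul_card.trans ?_)
    have hk2 : 2 ≤ k := by
      by_contra! hk'
      interval_cases k <;> lia
    rw [card_univ, hcard]
    nlinarith
  · push Not at hdeg
    obtain ⟨r, hr⟩ := hdeg
    obtain ⟨T, rfl⟩ := exists_rooting hG r
    exact T.burningNumber_le_of_weight_le ((Rooting.weight_univ_le hr).trans hk)

theorem IsTreeWithNonLeafDegreeGE.card_filter_degree_eq_two {d : ℕ} (hd : 3 ≤ d)
    (hG : IsTreeWithNonLeafDegreeGE G d) : #{v | G.degree v = 2} = 0 := by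
  rw [card_filter_eq_zero_iff]
  intro v _ hv
  have := hG.2 v (by lia)
  lia

end Tree

end GraphBurning

open Finset in
theorem theorem4p2_general {V : Type*} [Fintype V] {G : SimpleGraph V} [DecidableRel G.Adj]
    (hG : G.IsTree) :
    GraphBurning.burningNumber G ≤ ⌈√(Fintype.card V + #{v | G.degree v = 2} : ℝ)⌉₊ := by
  refine GraphBurning.burningNumber_le_of_card_add_le_sq hG ?_
  have hsq := (Real.sqrt_le_left (Nat.cast_nonneg _)).1
    (Nat.le_ceil √(Fintype.card V + #{v | G.degree v = 2} : ℝ))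
  exact_mod_cast hsq

theorem theorem4p2 {V : Type*} [Fintype V] (G : SimpleGraph V) [DecidableRel G.Adj] :
    (∀ d : ℕ, 4 ≤ d → GraphBurning.IsTreeWithNonLeafDegreeGE G d →
      GraphBurning.IsWellBurnable G) ∧
    (GraphBurning.IsTreeWithNonLeafDegreeGE G 3 → 81 ≤ Fintype.card V →
      GraphBurning.IsWellBurnable G) := by
  simp only [GraphBurning.IsWellBurnable]
  refine ⟨fun d hd hG => ?_, fun hG _ => ?_⟩
  · simpa [hG.card_filter_degree_eq_two (by lia)] using theorem4p2_general hG.1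
  · simpa [hG.card_filter_degree_eq_two le_rfl] using theorem4p2_general hG.1
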